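/- For $s>0$ let $H_s=L_2\big((0,\infty);e^{-sx}\,dx\big)$ be the real Hilbert space of (classes of) functions $f$ with $\int_0^\infty e^{-sx}f(x)^2\,dx<\infty$. Let $L_k(x)=\sum_{j=0}^k(-1)^j\binom kj\frac{x^j}{j!}$ be the Laguerre polynomials and $L^*_{k,s}(x)=(-1)^k\sqrt s\,L_k(sx)$. The Laplace-type transform of $f$ is the sequence of functions $$\mathcal G\{f\}_n(s)=\int_0^\infty e^{-st}\,\frac{t^n}{n!}\,f(t)\,dt\qquad(n=0,1,2,\dots).$$ For a sequence of real functions $\varphi=(\varphi_n(s))_{n\ge0}$ put $c_k(\varphi,s)=\Delta_n^k\big(s^n\varphi_n(s)\big)\big|_{n=0}$, where $\Delta_n t_n=t_{n+1}-t_n$, and say that $\varphi$ belongs to $S_c$ at $s$ if $\sum_{k\ge0}c_k(\varphi,s)^2<\infty$. For such $\varphi$ define $$\mathcal R\{\varphi\}=\sum_{k=0}^\infty \sqrt s\;c_k(\varphi,s)\,L^*_{k,s},$$ the series being taken in the norm of $H_s$. Theorem. The transforms $\mathcal G$ and $\mathcal R$ are inverse to each other. More precisely: (a) If $f$ is real-valued,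 piecewise continuous on $(0,\infty)$ and of exponential order $r>0$, that is, $|f(t)|<Me^{rt}$ for all $t>0$ and some $M>0$, then $f\in H_s$ for every $s>2r$, so that (b) applies to $f$ for every such $s$. (b) Let $s>0$ and $f\in H_s$. Then the integrals $\mathcal G\{f\}_n(s)$ converge absolutely for all $n$, the sequence $\mathcal G\{f\}$ belongs to $S_c$ at $s$, and the Laguerre series $\mathcal R\{\mathcal G\{f\}\}$ converges in $H_s$ to $f$; that is, $\mathcal R\{\mathcal G\{f\}\}=f$ in $H_s$ (almost everywhere on $(0,\infty)$). (c) Let $s>0$ and let $\varphi$ belong to $S_c$ at $s$. Then the series defining $\mathcal R\{\varphi\}$ converges in $H_s$, and for every function $f$ with $f=\mathcal R\{\varphi\}$ almost everywhere on $(0,\infty)$ and every $n\ge0$ the integral $\mathcal G\{f\}_n(s)$ converges absolutely and $\mathcal G\{f\}_n(s)=\varphi_n(s)$. -/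

import Mathlib

open MeasureTheory Set Filter Topology

namespace LaplaceType

noncomputable section

/-- The Laplace-type transform `φ_n(s) = ∫_0^∞ e^{-st} (t^n / n!) f(t) dt`, a sequence of functions. -/
def gt (f : ℝ → ℝ) (n : ℕ) (s : ℝ) : ℝ :=
  ∫ t in Ioi (0 : ℝ), Real.exp (-(s * t)) * (t ^ n / (n.factorial : ℝ)) * f t

/-- Convergence of the integral defining `gt f n s`. -/
def GtConverges (f : ℝ → ℝ) (n : ℕ) (s : ℝ) : Prop :=
  IntegrableOn (fun t : ℝ => Real.exp (-(s * t)) * (t ^ n / (n.factorial : ℝ)) * f t) (Ioi 0)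

/-- Piecewise continuity on `(0, ∞)`: on each compact subinterval only finitely many
discontinuities, and finite one-sided limits everywhere. -/
def PiecewiseContinuous (f : ℝ → ℝ) : Prop :=
  (∀ a b : ℝ, 0 < a → {x ∈ Icc a b | ¬ ContinuousAt f x}.Finite) ∧
  ∀ x : ℝ, 0 < x → (∃ l : ℝ, Tendsto f (𝓝[<] x) (𝓝 l)) ∧ (∃ l : ℝ, Tendsto f (𝓝[>] x) (𝓝 l))

/-- `f` is of exponential order `r` on `(0, ∞)`. -/
def ExpOrder (f : ℝ → ℝ) (r : ℝ) : Prop :=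
  ∃ M : ℝ, 0 < M ∧ ∀ t : ℝ, 0 < t → |f t| < M * Real.exp (r * t)

/-- The measure `e^{-sx} dx` on `(0, ∞)`. -/
def weight (s : ℝ) : Measure ℝ :=
  (volume.restrict (Ioi (0 : ℝ))).withDensity (fun x => ENNReal.ofReal (Real.exp (-(s * x))))

/-- The Laguerre polynomial `L_n(x)`. -/
def laguerre (n : ℕ) (x : ℝ) : ℝ :=
  ∑ k ∈ Finset.range (n + 1), (-1) ^ k * (n.choose k : ℝ) * (x ^ k / (k.factorial : ℝ))

/-- The Laguerre function `L*_{n,s}(x) = (-1)^n √s L_n(s x)`. -/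
def laguerreFn (n : ℕ) (s x : ℝ) : ℝ :=
  (-1) ^ n * Real.sqrt s * laguerre n (s * x)

theorem memLp_pow {s : ℝ} (hs : 0 < s) (k : ℕ) : MemLp (fun x : ℝ => x ^ k) 2 (weight s) := by
  rw [memLp_two_iff_integrable_sq (by fun_prop), weight,
    integrable_withDensity_iff (by fun_prop) (by simp)]
  have h := integrableOn_rpow_mul_exp_neg_mul_rpow (p := 1) (s := ((2 * k : ℕ) : ℝ)) (b := s)
    (by have : (0 : ℝ) ≤ ((2 * k : ℕ) : ℝ) := Nat.cast_nonneg _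
        linarith) one_pos hs
  refine h.congr_fun (fun x _ => ?_) measurableSet_Ioi
  simp only [Real.rpow_natCast, Real.rpow_one]
  rw [ENNReal.toReal_ofReal (Real.exp_pos _).le, ← pow_mul, mul_comm k 2, neg_mul]

theorem memLp_laguerreFn {s : ℝ} (hs : 0 < s) (n : ℕ) :
    MemLp (laguerreFn n s) 2 (weight s) := by
  have h : MemLp (fun x : ℝ => ∑ k ∈ Finset.range (n + 1),
      ((-1) ^ n * Real.sqrt s * ((-1) ^ k * (n.choose k : ℝ) * (s ^ k / (k.factorial : ℝ)))) *
        x ^ k) 2 (weight s) :=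
    memLp_finsetSum _ fun k _ => (memLp_pow hs k).const_mul _
  have e : laguerreFn n s = fun x : ℝ => ∑ k ∈ Finset.range (n + 1),
      ((-1) ^ n * Real.sqrt s * ((-1) ^ k * (n.choose k : ℝ) * (s ^ k / (k.factorial : ℝ)))) *
        x ^ k := by
    funext x
    rw [laguerreFn, laguerre, Finset.mul_sum]
    refine Finset.sum_congr rfl fun k _ => ?_
    rw [mul_pow]
    ring
  rw [e]
  exact h

/-- `L*_{n,s}` as an element of the Hilbert space `L₂(0, ∞; e^{-sx})`. -/
def laguerreLp {s : ℝ} (hs : 0 < s) (n : ℕ) : Lp ℝ 2 (weight s) :=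
  (memLp_laguerreFn hs n).toLp (laguerreFn n s)

/-- The number `Δ_n^k (s^n φ_n(s))` at `n = 0`. -/
def diffCoeff (φ : ℕ → ℝ → ℝ) (s : ℝ) (k : ℕ) : ℝ :=
  (fwdDiff (1 : ℕ))^[k] (fun n : ℕ => s ^ n * φ n s) 0

/-- The condition, at the point `s`, that defines the sequence space `S_c`. -/
def Sc (s : ℝ) : Set (ℕ → ℝ → ℝ) :=
  {φ | Summable fun k : ℕ => (diffCoeff φ s k) ^ 2}

/-- The `k`-th term `√s Δ_n^k (s^n φ_n(s))|_{n=0} L*_{k,s}` of the series that defines `rt`. -/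
def rtTerm {s : ℝ} (hs : 0 < s) (φ : ℕ → ℝ → ℝ) (k : ℕ) : Lp ℝ 2 (weight s) :=
  (Real.sqrt s * diffCoeff φ s k) • laguerreLp hs k

/-- The map `rt`: the sum, in `L₂(0, ∞; e^{-sx})`, of the Laguerre series. -/
def rt {s : ℝ} (hs : 0 < s) (φ : ℕ → ℝ → ℝ) : Lp ℝ 2 (weight s) :=
  ∑' k : ℕ, rtTerm hs φ k

end

end LaplaceType

/-! Expanding `laguerreFn` shows that the inner product of `L*_{k,s}` with `f` in `H_s` is `√s`
times the `k`-th difference at `0` of `s^n` times the transform (`integral_laguerreFn_mul`). So the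
series for `rt hs (gt f)` is the Fourier expansion of `f` in Laguerre functions, and all rests on
these being a Hilbert basis. Orthonormality uses the same identity: for `x^m` the scaled transform
is a multiple of `(n+m).choose m`, a polynomial of degree `m` in `n`, killed by differences of order
above `m`. For completeness, a function orthogonal to all `L*_{k,s}` has zero moments by Newton's
formula, and `ae_eq_zero_of_moments_eq_zero` makes it vanish. Conversely, square-summable
coefficients define an element of `H_s` (Riesz–Fischer), and Newton's formula recovers `φ_n(s)` from
the differences. -/

namespace LaplaceType

noncomputable section

/-! ### The weighted measure -/

section Weight

theorem integrable_weight_iff {s : ℝ} {g : ℝ → ℝ} :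
    Integrable g (weight s) ↔ IntegrableOn (fun x => Real.exp (-(s * x)) * g x) (Ioi 0) := by
  rw [weight, integrable_withDensity_iff (by fun_prop) (by simp), IntegrableOn]
  refine integrable_congr (Eventually.of_forall fun x => ?_)
  simp only [ENNReal.toReal_ofReal (Real.exp_pos _).le, mul_comm]

theorem integral_weight (s : ℝ) (g : ℝ → ℝ) :
    ∫ x, g x ∂(weight s) = ∫ x in Ioi (0 : ℝ), Real.exp (-(s * x)) * g x := by
  rw [weight, integral_withDensity_eq_integral_toReal_smul (by fun_prop) (by simp)]
  simp only [ENNReal.toReal_ofReal (Real.exp_pos _).le, smul_eq_mul]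

theorem ae_weight_pos (s : ℝ) : ∀ᵐ x ∂(weight s), 0 < x :=
  (withDensity_absolutelyContinuous _ _).ae_le (ae_restrict_mem measurableSet_Ioi)

/-- Squaring doubles the exponent; this is where the bound `s > 2r` comes from. -/
theorem memLp_exp_mul {s t : ℝ} (h : 2 * t < s) :
    MemLp (fun x : ℝ => Real.exp (t * x)) 2 (weight s) := by
  rw [memLp_two_iff_integrable_sq (by fun_prop), integrable_weight_iff]
  refine (exp_neg_integrableOn_Ioi 0 (sub_pos.2 h)).congr_fun (fun x _ => ?_) measurableSet_Ioi
  simp only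
  rw [← Real.exp_nat_mul, ← Real.exp_add]
  congr 1
  push_cast
  ring

theorem isFiniteMeasure_weight {s : ℝ} (hs : 0 < s) : IsFiniteMeasure (weight s) := by
  have h := (memLp_pow hs 0).integrable_sq
  simp only [pow_zero, one_pow] at h
  exact (integrable_const_iff_isFiniteMeasure one_ne_zero).1 h

end Weight

/-! ### Functions of exponential order -/

section ExponentialOrder

/-- Exhausting `(0, ∞)` by compact intervals shows that the discontinuities are countable, hence
null; off them `f` is continuous. -/
theorem PiecewiseContinuous.aestronglyMeasurable {f : ℝ → ℝ} (hf : PiecewiseContinuous f) :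
    AEStronglyMeasurable f (volume.restrict (Ioi (0 : ℝ))) := by
  set D : Set ℝ := {x ∈ Ioi (0 : ℝ) | ¬ ContinuousAt f x}
  have hDc : D.Countable := by
    have : D ⊆ ⋃ n : ℕ, {x ∈ Icc (1 / ((n : ℝ) + 1)) n | ¬ ContinuousAt f x} := by
      rintro x ⟨hx, hxf⟩
      obtain ⟨m, hm⟩ := exists_nat_one_div_lt (mem_Ioi.1 hx)
      obtain ⟨k, hk⟩ := exists_nat_ge x
      refine mem_iUnion.2 ⟨max m k, ⟨?_, ?_⟩, hxf⟩
      · refine le_trans ?_ hm.le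
        refine one_div_le_one_div_of_le (by positivity) ?_
        gcongr
        exact le_max_left _ _
      · exact hk.trans (by exact_mod_cast le_max_right m k)
    exact (countable_iUnion fun n => (hf.1 _ _ (by positivity)).countable).mono this
  have hcont : ContinuousOn f (Ioi 0 \ D) := fun x hx =>
    (not_not.1 fun h => hx.2 ⟨hx.1, h⟩ : ContinuousAt f x).continuousWithinAt
  have hmeas : MeasurableSet (Ioi (0 : ℝ) \ D) := measurableSet_Ioi.diff hDc.measurableSet
  have h := hcont.aestronglyMeasurable (μ := volume) hmeas
  rwa [Measure.restrict_congr_set (sdiff_null_ae_eq_self (hDc.measure_zero volume))] at h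

theorem memLp_of_expOrder {f : ℝ → ℝ} {r s : ℝ} (hf : PiecewiseContinuous f)
    (hr : ExpOrder f r) (hs : 2 * r < s) : MemLp f 2 (weight s) := by
  obtain ⟨M, -, hM⟩ := hr
  refine (memLp_exp_mul hs).of_le_mul (c := M)
    (hf.aestronglyMeasurable.mono_ac (withDensity_absolutelyContinuous _ _)) ?_
  filter_upwards [ae_weight_pos s] with x hx
  rw [Real.norm_eq_abs, Real.norm_of_nonneg (Real.exp_pos _).le]
  exact (hM x hx).le

end ExponentialOrder

/-! ### Finite differences -/

section Differences

theorem fwdDiff_iter_zero_fun (k : ℕ) : (fwdDiff (1 : ℕ))^[k] (fun _ : ℕ => (0 : ℝ)) = fun _ => 0 := by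
  induction k with
  | zero => rfl
  | succ k ih => rw [Function.iterate_succ_apply', ih, fwdDiff_const]

/-- By Pascal's rule each difference lowers the bottom index by one. -/
theorem fwdDiff_iter_choose_add (a j k : ℕ) :
    (fwdDiff (1 : ℕ))^[k] (fun n : ℕ => ((n + a).choose (k + j) : ℝ)) =
      fun n => ((n + a).choose j : ℝ) := by
  induction k generalizing j with
  | zero => simp
  | succ k ih =>
    rw [Function.iterate_succ_apply', show k + 1 + j = k + (j + 1) by ring, ih]
    funext n
    rw [fwdDiff, show n + 1 + a = n + a + 1 by ring, Nat.choose_succ_succ]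
    push_cast
    ring

theorem fwdDiff_iter_choose_add_of_lt (a : ℕ) {m k : ℕ} (h : m < k) :
    (fwdDiff (1 : ℕ))^[k] (fun n : ℕ => ((n + a).choose m : ℝ)) = fun _ => 0 := by
  obtain ⟨d, rfl⟩ := Nat.exists_eq_add_of_lt h
  have e := fwdDiff_iter_choose_add a 0 m
  rw [add_zero] at e
  rw [show m + d + 1 = d + 1 + m by ring, Function.iterate_add_apply, e,
    Function.iterate_succ_apply]
  simp only [Nat.choose_zero_right, fwdDiff_const]
  exact fwdDiff_iter_zero_fun d

theorem diffCoeff_eq_sum (φ : ℕ → ℝ → ℝ) (s : ℝ) (k : ℕ) :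
    diffCoeff φ s k =
      ∑ j ∈ Finset.range (k + 1), (-1) ^ (k - j) * (k.choose j : ℝ) * (s ^ j * φ j s) := by
  rw [diffCoeff, fwdDiff_iter_eq_sum_shift]
  refine Finset.sum_congr rfl fun j _ => ?_
  simp

/-- Newton's formula: the differences at `0` determine the sequence. -/
theorem eq_of_diffCoeff_eq {s : ℝ} (hs : 0 < s) {φ ψ : ℕ → ℝ → ℝ}
    (h : ∀ k, diffCoeff φ s k = diffCoeff ψ s k) (n : ℕ) : φ n s = ψ n s := by
  have key : ∀ χ : ℕ → ℝ → ℝ, s ^ n * χ n s =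
      ∑ k ∈ Finset.range (n + 1), n.choose k • diffCoeff χ s k := fun χ => by
    simpa [diffCoeff] using shift_eq_sum_fwdDiff_iter (1 : ℕ) (fun n : ℕ => s ^ n * χ n s) n 0
  have e : s ^ n * φ n s = s ^ n * ψ n s := by simp only [key, h]
  exact mul_left_cancel₀ (pow_pos hs n).ne' e

end Differences

/-! ### The transform as Laguerre coefficients -/

section Transform

theorem gtConverges_iff {f : ℝ → ℝ} {n : ℕ} {s : ℝ} :
    GtConverges f n s ↔ Integrable (fun x => x ^ n / (n.factorial : ℝ) * f x) (weight s) := by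
  rw [GtConverges, integrable_weight_iff]
  simp only [mul_assoc]

theorem gt_eq_integral_weight (f : ℝ → ℝ) (n : ℕ) (s : ℝ) :
    gt f n s = ∫ x, x ^ n / (n.factorial : ℝ) * f x ∂(weight s) := by
  rw [gt, integral_weight]
  simp only [mul_assoc]

theorem gtConverges_of_memLp {s : ℝ} (hs : 0 < s) {f : ℝ → ℝ} (hf : MemLp f 2 (weight s)) (n : ℕ) :
    GtConverges f n s := by
  rw [gtConverges_iff]
  have h := ((memLp_pow hs n).mul_const ((n.factorial : ℝ)⁻¹)).integrable_mul hf
  simp only [div_eq_mul_inv]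
  exact h

/-- The sign `(-1)^k` in `L*_{k,s}` turns the Laguerre sign `(-1)^j` into the `(-1)^(k-j)` of the
binomial formula for differences. -/
theorem integral_laguerreFn_mul {s : ℝ} (hs : 0 < s) {f : ℝ → ℝ} (hf : MemLp f 2 (weight s))
    (k : ℕ) :
    ∫ x, laguerreFn k s x * f x ∂(weight s) = Real.sqrt s * diffCoeff (gt f) s k := by
  have e : ∀ x, laguerreFn k s x * f x = ∑ j ∈ Finset.range (k + 1),
      Real.sqrt s * ((-1) ^ (k - j) * (k.choose j : ℝ) * s ^ j) *
        (x ^ j / (j.factorial : ℝ) * f x) := fun x => by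
    rw [laguerreFn, laguerre, Finset.mul_sum, Finset.sum_mul]
    refine Finset.sum_congr rfl fun j hj => ?_
    obtain ⟨d, rfl⟩ := Nat.exists_eq_add_of_le (Nat.lt_succ_iff.1 (Finset.mem_range.1 hj))
    rw [Nat.add_sub_cancel_left, mul_pow, pow_add]
    have : ((-1 : ℝ) ^ j) * (-1) ^ j = 1 := by rw [← mul_pow]; simp
    linear_combination (Real.sqrt s * (-1) ^ d * ((j + d).choose j : ℝ) * s ^ j * x ^ j /
      (j.factorial : ℝ) * f x) * this
  simp only [e]
  rw [integral_finsetSum _ fun j _ => (gtConverges_iff.1 (gtConverges_of_memLp hs hf j)).const_mul _,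
    diffCoeff_eq_sum, Finset.mul_sum]
  refine Finset.sum_congr rfl fun j _ => ?_
  rw [integral_const_mul, ← gt_eq_integral_weight]
  ring

theorem inner_laguerreLp {s : ℝ} (hs : 0 < s) {f : ℝ → ℝ} (hf : MemLp f 2 (weight s)) (k : ℕ) :
    inner ℝ (laguerreLp hs k) (hf.toLp f) = Real.sqrt s * diffCoeff (gt f) s k := by
  rw [← integral_laguerreFn_mul hs hf, L2.inner_def]
  refine integral_congr_ae ?_
  filter_upwards [(memLp_laguerreFn hs k).coeFn_toLp, hf.coeFn_toLp] with x h1 h2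
  rw [laguerreLp, h1, h2, Real.inner_apply]

end Transform

/-! ### Orthonormality of the Laguerre functions -/

section Orthonormal

/-- A Gamma integral: `(n+m)!/n!` is `m!` times a binomial coefficient. -/
theorem gt_pow {s : ℝ} (hs : 0 < s) (m n : ℕ) :
    s ^ n * gt (fun x => x ^ m) n s =
      (m.factorial : ℝ) / s ^ (m + 1) * ((n + m).choose m : ℝ) := by
  have h := Real.integral_rpow_mul_exp_neg_mul_Ioi (a := ((n + m : ℕ) : ℝ) + 1) (by positivity) hs
  rw [Real.Gamma_nat_eq_factorial, add_sub_cancel_right] at h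
  have e : gt (fun x => x ^ m) n s = (n.factorial : ℝ)⁻¹ *
      ∫ t in Ioi (0 : ℝ), t ^ ((n + m : ℕ) : ℝ) * Real.exp (-(s * t)) := by
    rw [gt, ← integral_const_mul]
    refine setIntegral_congr_fun measurableSet_Ioi fun t _ => ?_
    simp only [Real.rpow_natCast, pow_add]
    ring
  rw [e, h, show ((n + m : ℕ) : ℝ) + 1 = ((n + m + 1 : ℕ) : ℝ) by push_cast; rfl,
    Real.rpow_natCast, Nat.choose_symm_add.symm, Nat.cast_add_choose]
  have := hs.ne'
  have := Nat.factorial_ne_zero n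
  have := Nat.factorial_ne_zero m
  rw [one_div, inv_pow]
  field_simp
  ring

theorem diffCoeff_gt_pow {s : ℝ} (hs : 0 < s) (m k : ℕ) :
    diffCoeff (gt fun x => x ^ m) s k = (m.factorial : ℝ) / s ^ (m + 1) *
      (fwdDiff (1 : ℕ))^[k] (fun n : ℕ => ((n + m).choose m : ℝ)) 0 := by
  simp only [diffCoeff, gt_pow hs]
  have := congrFun (fwdDiff_iter_const_smul (1 : ℕ) ((m.factorial : ℝ) / s ^ (m + 1))
    (fun n : ℕ => ((n + m).choose m : ℝ)) k) 0
  simpa [Pi.smul_def] using this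

theorem integral_laguerreFn_mul_pow_of_lt {s : ℝ} (hs : 0 < s) {m k : ℕ} (h : m < k) :
    ∫ x, laguerreFn k s x * x ^ m ∂(weight s) = 0 := by
  rw [integral_laguerreFn_mul hs (memLp_pow hs m), diffCoeff_gt_pow hs,
    fwdDiff_iter_choose_add_of_lt m h]
  simp

theorem integral_laguerreFn_mul_pow_self {s : ℝ} (hs : 0 < s) (k : ℕ) :
    ∫ x, laguerreFn k s x * x ^ k ∂(weight s) =
      Real.sqrt s * ((k.factorial : ℝ) / s ^ (k + 1)) := by
  have e := fwdDiff_iter_choose_add k 0 k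
  rw [add_zero] at e
  rw [integral_laguerreFn_mul hs (memLp_pow hs k), diffCoeff_gt_pow hs, e]
  simp

theorem integral_laguerreFn_mul_laguerreFn {s : ℝ} (hs : 0 < s) (j k : ℕ) :
    ∫ x, laguerreFn k s x * laguerreFn j s x ∂(weight s) =
      ∑ m ∈ Finset.range (j + 1),
        ((-1) ^ j * Real.sqrt s * ((-1) ^ m * (j.choose m : ℝ) * (s ^ m / (m.factorial : ℝ)))) *
          ∫ x, laguerreFn k s x * x ^ m ∂(weight s) := by
  simp only [← integral_const_mul]
  rw [← integral_finsetSum]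
  · refine integral_congr_ae (Eventually.of_forall fun x => ?_)
    simp only
    conv_lhs => rw [laguerreFn.eq_1 j, laguerre, Finset.mul_sum, Finset.mul_sum]
    refine Finset.sum_congr rfl fun m _ => ?_
    rw [mul_pow]
    ring
  · exact fun m _ => ((memLp_laguerreFn hs k).integrable_mul (memLp_pow hs m)).const_mul _

theorem integral_laguerreFn_of_lt {s : ℝ} (hs : 0 < s) {j k : ℕ} (h : j < k) :
    ∫ x, laguerreFn k s x * laguerreFn j s x ∂(weight s) = 0 := by
  rw [integral_laguerreFn_mul_laguerreFn hs]
  refine Finset.sum_eq_zero fun m hm => ?_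
  rw [integral_laguerreFn_mul_pow_of_lt hs (by have := Finset.mem_range.1 hm; omega), mul_zero]

theorem integral_laguerreFn_self {s : ℝ} (hs : 0 < s) (k : ℕ) :
    ∫ x, laguerreFn k s x * laguerreFn k s x ∂(weight s) = 1 := by
  -- Only the leading monomial `x^k` contributes.
  rw [integral_laguerreFn_mul_laguerreFn hs, Finset.sum_range_succ, Finset.sum_eq_zero, zero_add,
    integral_laguerreFn_mul_pow_self hs]
  · have h1 : ((-1 : ℝ) ^ k) * (-1) ^ k = 1 := by rw [← mul_pow]; simp
    have h2 := Real.mul_self_sqrt hs.le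
    have := hs.ne'
    have := Nat.factorial_ne_zero k
    rw [Nat.choose_self, Nat.cast_one]
    calc _ = ((-1 : ℝ) ^ k * (-1) ^ k) * (Real.sqrt s * Real.sqrt s) *
          (s ^ k / (k.factorial : ℝ) * ((k.factorial : ℝ) / s ^ (k + 1))) := by ring
      _ = 1 := by
        rw [h1, h2]
        field_simp
        ring
  · intro m hm
    rw [integral_laguerreFn_mul_pow_of_lt hs (Finset.mem_range.1 hm), mul_zero]

theorem inner_laguerreLp_laguerreLp {s : ℝ} (hs : 0 < s) (j k : ℕ) :
    inner ℝ (laguerreLp hs k) (laguerreLp hs j) =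
      ∫ x, laguerreFn k s x * laguerreFn j s x ∂(weight s) := by
  rw [integral_laguerreFn_mul hs (memLp_laguerreFn hs j), ← inner_laguerreLp hs (memLp_laguerreFn hs j),
    laguerreLp]
  rfl

theorem orthonormal_laguerreLp {s : ℝ} (hs : 0 < s) : Orthonormal ℝ (laguerreLp hs) := by
  rw [orthonormal_iff_ite]
  intro k j
  rcases lt_trichotomy j k with h | rfl | h
  · rw [if_neg h.ne', inner_laguerreLp_laguerreLp, integral_laguerreFn_of_lt hs h]
  · rw [if_pos rfl, inner_laguerreLp_laguerreLp, integral_laguerreFn_self]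
    exact hs
  · rw [if_neg h.ne, real_inner_comm, inner_laguerreLp_laguerreLp, integral_laguerreFn_of_lt hs h]

end Orthonormal

/-! ### Determinacy of moments and totality of polynomials -/

section Moments

theorem eventuallyEq_of_hasFPowerSeriesAt {f g : ℂ → ℂ} {p : FormalMultilinearSeries ℂ ℂ ℂ} {z : ℂ}
    (hf : HasFPowerSeriesAt f p z) (hg : HasFPowerSeriesAt g p z) : f =ᶠ[𝓝 z] g := by
  filter_upwards [hf.eventually_hasSum_sub, hg.eventually_hasSum_sub] with w h1 h2
  exact h1.unique h2

open ProbabilityTheory Complex in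
/-- Finite measures on the line with finite exponential moments are determined by their moments. -/
theorem measure_eq_of_moments_eq {μ ν : Measure ℝ} [IsFiniteMeasure μ] [IsFiniteMeasure ν]
    (hμ : 0 ∈ interior (integrableExpSet id μ)) (hν : 0 ∈ interior (integrableExpSet id ν))
    (h : ∀ n : ℕ, ∫ x, x ^ n ∂μ = ∫ x, x ^ n ∂ν) : μ = ν := by
  set J : Set ℝ := interior (integrableExpSet id μ) ∩ interior (integrableExpSet id ν)
  set U : Set ℂ := {z | z.re ∈ J}
  have hUc : IsPreconnected U :=
    ((convex_integrableExpSet.interior.inter convex_integrableExpSet.interior).linear_preimage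
      Complex.reLm).isPreconnected
  have hAμ : AnalyticOnNhd ℂ (complexMGF id μ) U := analyticOnNhd_complexMGF.mono fun z hz => hz.1
  have hAν : AnalyticOnNhd ℂ (complexMGF id ν) U := analyticOnNhd_complexMGF.mono fun z hz => hz.2
  have h0 : (0 : ℂ) ∈ U := ⟨by simpa using hμ, by simpa using hν⟩
  have hd : ∀ n : ℕ, iteratedDeriv n (complexMGF id μ) 0 = iteratedDeriv n (complexMGF id ν) 0 := by
    intro n
    rw [iteratedDeriv_complexMGF h0.1, iteratedDeriv_complexMGF h0.2]
    simp only [id_eq, zero_mul, Complex.exp_zero, mul_one, ← Complex.ofReal_pow]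
    rw [integral_complex_ofReal, integral_complex_ofReal, h n]
  -- The moments are the derivatives at `0`, so the Taylor series coincide.
  have hev : complexMGF id μ =ᶠ[𝓝 0] complexMGF id ν := by
    have h1 := (hAμ 0 h0).hasFPowerSeriesAt
    simp only [hd] at h1
    exact eventuallyEq_of_hasFPowerSeriesAt h1 (hAν 0 h0).hasFPowerSeriesAt
  have heq := hAμ.eqOn_of_preconnected_of_eventuallyEq hAν hUc h0 hev
  -- The strip `U` contains the imaginary axis, where the complex MGF is the characteristic
  -- function.
  refine Measure.ext_of_charFun (funext fun t => ?_)
  rw [← complexMGF_id_mul_I, ← complexMGF_id_mul_I]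
  exact heq ⟨by simpa using hμ, by simpa using hν⟩

theorem integrable_withDensity_ofReal {s : ℝ} {g h : ℝ → ℝ} (hg : MemLp g 2 (weight s))
    (hh : MemLp h 2 (weight s)) :
    Integrable h ((weight s).withDensity fun x => ENNReal.ofReal (g x)) := by
  rw [integrable_withDensity_iff_integrable_smul₀' hg.aestronglyMeasurable.aemeasurable.ennreal_ofReal
    (by simp)]
  have := hg.pos_part.integrable_mul hh
  refine this.congr (Eventually.of_forall fun x => ?_)
  simp [ENNReal.toReal_ofReal', smul_eq_mul]

/-- For `t < s / 2` both `e^{tx}` and `g` lie in `H_s`, so their product is integrable. -/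
theorem zero_mem_interior_integrableExpSet {s : ℝ} (hs : 0 < s) {g : ℝ → ℝ}
    (hg : MemLp g 2 (weight s)) :
    0 ∈ interior (ProbabilityTheory.integrableExpSet id
      ((weight s).withDensity fun x => ENNReal.ofReal (g x))) := by
  refine mem_interior.2 ⟨Iio (s / 2), fun t ht => ?_, isOpen_Iio, by simpa using hs⟩
  exact integrable_withDensity_ofReal hg (memLp_exp_mul (by have := mem_Iio.1 ht; linarith))

theorem integral_withDensity_ofReal {s : ℝ} {g : ℝ → ℝ} (hg : MemLp g 2 (weight s)) (h : ℝ → ℝ) :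
    ∫ x, h x ∂((weight s).withDensity fun x => ENNReal.ofReal (g x)) =
      ∫ x, max (g x) 0 * h x ∂(weight s) := by
  rw [integral_withDensity_eq_integral_toReal_smul₀
    hg.aestronglyMeasurable.aemeasurable.ennreal_ofReal (by simp)]
  simp [ENNReal.toReal_ofReal', smul_eq_mul]

/-- Polynomials are total in `L₂(0, ∞; e^{-sx})`. -/
theorem ae_eq_zero_of_moments_eq_zero {s : ℝ} (hs : 0 < s) {g : ℝ → ℝ} (hg : MemLp g 2 (weight s))
    (h : ∀ n : ℕ, ∫ x, x ^ n * g x ∂(weight s) = 0) : g =ᵐ[weight s] 0 := by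
  have := isFiniteMeasure_weight hs
  have hg' : MemLp (fun x => -g x) 2 (weight s) := hg.neg
  have := isFiniteMeasure_withDensity_ofReal (hg.integrable one_le_two).2
  have := isFiniteMeasure_withDensity_ofReal (hg'.integrable one_le_two).2
  -- `ENNReal.ofReal` truncates at `0`, so the two measures have densities `g⁺` and `g⁻`; their
  -- moments differ by those of `g`.
  have hm := measure_eq_of_moments_eq (zero_mem_interior_integrableExpSet hs hg)
    (zero_mem_interior_integrableExpSet hs hg') fun n => by
      have h1 : Integrable (fun x => max (g x) 0 * x ^ n) (weight s) :=
        hg.pos_part.integrable_mul (memLp_pow hs n)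
      have h2 : Integrable (fun x => max (-g x) 0 * x ^ n) (weight s) :=
        hg'.pos_part.integrable_mul (memLp_pow hs n)
      rw [integral_withDensity_ofReal hg, integral_withDensity_ofReal hg', ← sub_eq_zero,
        ← integral_sub h1 h2]
      refine (integral_congr_ae (Eventually.of_forall fun x => ?_)).trans (h n)
      rw [← sub_mul, max_zero_sub_max_neg_zero_eq_self, mul_comm]
  rw [withDensity_eq_iff hg.aestronglyMeasurable.aemeasurable.ennreal_ofReal
    hg'.aestronglyMeasurable.aemeasurable.ennreal_ofReal
    (hg.integrable one_le_two).lintegral_lt_top.ne] at hm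
  filter_upwards [hm] with x hx
  rcases le_total (g x) 0 with h0 | h0
  · rw [ENNReal.ofReal_of_nonpos h0, eq_comm, ENNReal.ofReal_eq_zero] at hx
    exact le_antisymm h0 (neg_nonpos.1 hx)
  · rw [ENNReal.ofReal_of_nonpos (neg_nonpos.2 h0), ENNReal.ofReal_eq_zero] at hx
    exact le_antisymm hx h0

end Moments

/-! ### The Laguerre basis and inversion -/

section Basis

theorem span_laguerreLp_orthogonal {s : ℝ} (hs : 0 < s) :
    (Submodule.span ℝ (range (laguerreLp hs)))ᗮ = ⊥ := by
  rw [Submodule.eq_bot_iff]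
  intro u hu
  -- Comparison with the zero sequence lets Newton's formula annihilate every moment.
  have hc : ∀ k, diffCoeff (gt u) s k = diffCoeff (fun _ _ => 0) s k := fun k => by
    have h1 := (Submodule.mem_orthogonal _ _).1 hu _ (Submodule.subset_span ⟨k, rfl⟩)
    rw [← Lp.toLp_coeFn u (Lp.memLp u), inner_laguerreLp,
      mul_eq_zero_iff_left (Real.sqrt_pos.2 hs).ne'] at h1
    rw [h1, diffCoeff_eq_sum]
    simp
  refine (Lp.eq_zero_iff_ae_eq_zero).2 (ae_eq_zero_of_moments_eq_zero hs (Lp.memLp u) fun n => ?_)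
  have h2 := eq_of_diffCoeff_eq hs hc n
  rw [gt_eq_integral_weight] at h2
  have h3 : ∫ x, x ^ n * u x ∂(weight s) =
      (n.factorial : ℝ) * ∫ x, x ^ n / (n.factorial : ℝ) * u x ∂(weight s) := by
    rw [← integral_const_mul]
    refine integral_congr_ae (Eventually.of_forall fun x => ?_)
    have := Nat.factorial_ne_zero n
    field_simp
  rw [h3, h2, mul_zero]

/-- The Laguerre functions form a Hilbert basis of `L₂(0, ∞; e^{-sx})`. -/
def laguerreBasis {s : ℝ} (hs : 0 < s) : HilbertBasis ℕ ℝ (Lp ℝ 2 (weight s)) :=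
  HilbertBasis.mkOfOrthogonalEqBot (orthonormal_laguerreLp hs) (span_laguerreLp_orthogonal hs)

theorem laguerreBasis_apply {s : ℝ} (hs : 0 < s) (k : ℕ) :
    laguerreBasis hs k = laguerreLp hs k := by
  rw [laguerreBasis, HilbertBasis.coe_mkOfOrthogonalEqBot]

theorem laguerreBasis_repr {s : ℝ} (hs : 0 < s) {f : ℝ → ℝ} (hf : MemLp f 2 (weight s)) (k : ℕ) :
    (laguerreBasis hs).repr (hf.toLp f) k = Real.sqrt s * diffCoeff (gt f) s k := by
  rw [HilbertBasis.repr_apply_apply, laguerreBasis_apply, inner_laguerreLp]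

theorem hasSum_rtTerm_gt {s : ℝ} (hs : 0 < s) {f : ℝ → ℝ} (hf : MemLp f 2 (weight s)) :
    HasSum (rtTerm hs (gt f)) (hf.toLp f) := by
  have h := (laguerreBasis hs).hasSum_repr (hf.toLp f)
  simp only [laguerreBasis_repr, laguerreBasis_apply] at h
  exact h

theorem gt_mem_Sc {s : ℝ} (hs : 0 < s) {f : ℝ → ℝ} (hf : MemLp f 2 (weight s)) : gt f ∈ Sc s := by
  -- The squared Fourier coefficients are `s` times the squared differences, hence the factor `s⁻¹`.
  have h := ((laguerreBasis hs).summable_inner_mul_inner (hf.toLp f) (hf.toLp f)).mul_left s⁻¹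
  refine h.congr fun k => ?_
  rw [real_inner_comm, laguerreBasis_apply, inner_laguerreLp]
  linear_combination ((diffCoeff (gt f) s k) ^ 2 * s⁻¹) * Real.mul_self_sqrt hs.le +
    (diffCoeff (gt f) s k) ^ 2 * inv_mul_cancel₀ hs.ne'

/-- Riesz–Fischer: the basis identifies `H_s` with `ℓ²`. -/
theorem exists_repr_eq {s : ℝ} (hs : 0 < s) {φ : ℕ → ℝ → ℝ} (hφ : φ ∈ Sc s) :
    ∃ u : Lp ℝ 2 (weight s), ∀ k, (laguerreBasis hs).repr u k = Real.sqrt s * diffCoeff φ s k := by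
  have hmem : Memℓp (fun k => Real.sqrt s * diffCoeff φ s k) 2 := by
    refine memℓp_gen ?_
    have h : Summable fun k => s * (diffCoeff φ s k) ^ 2 := Summable.mul_left s hφ
    refine h.congr fun k => ?_
    simp [mul_pow, Real.sq_sqrt hs.le]
  refine ⟨(laguerreBasis hs).repr.symm ⟨_, hmem⟩, fun k => ?_⟩
  rw [LinearIsometryEquiv.apply_symm_apply]

theorem hasSum_rtTerm {s : ℝ} (hs : 0 < s) {φ : ℕ → ℝ → ℝ} (hφ : φ ∈ Sc s) :
    HasSum (rtTerm hs φ) (rt hs φ) := by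
  obtain ⟨u, hu⟩ := exists_repr_eq hs hφ
  have h := (laguerreBasis hs).hasSum_repr u
  simp only [hu, laguerreBasis_apply] at h
  exact Summable.hasSum ⟨u, h⟩

theorem laguerreBasis_repr_rt {s : ℝ} (hs : 0 < s) {φ : ℕ → ℝ → ℝ} (hφ : φ ∈ Sc s) (k : ℕ) :
    (laguerreBasis hs).repr (rt hs φ) k = Real.sqrt s * diffCoeff φ s k := by
  obtain ⟨u, hu⟩ := exists_repr_eq hs hφ
  have h := (laguerreBasis hs).hasSum_repr u
  simp only [hu, laguerreBasis_apply] at h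
  rw [← hu, show rt hs φ = u from h.tsum_eq]

/-- The Laguerre coefficients of `f`, computed from `gt f` and from `φ`, give equal differences, so
Newton's formula applies. -/
theorem gt_rt {s : ℝ} (hs : 0 < s) {φ : ℕ → ℝ → ℝ} (hφ : φ ∈ Sc s) {f : ℝ → ℝ}
    (hf : f =ᵐ[weight s] rt hs φ) (n : ℕ) : GtConverges f n s ∧ gt f n s = φ n s := by
  have hfL : MemLp f 2 (weight s) := (memLp_congr_ae hf).2 (Lp.memLp _)
  have hlp : hfL.toLp f = rt hs φ := Lp.ext (hfL.coeFn_toLp.trans hf)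
  refine ⟨gtConverges_of_memLp hs hfL n, eq_of_diffCoeff_eq hs (fun k => ?_) n⟩
  have h := laguerreBasis_repr hs hfL k
  rw [hlp, laguerreBasis_repr_rt hs hφ] at h
  exact (mul_left_cancel₀ (Real.sqrt_pos.2 hs).ne' h).symm

end Basis

end

end LaplaceType

theorem mainTheorem1 :
    -- the functions of exponential order belong to the Hilbert spaces on which `gt` acts
    (∀ (f : ℝ → ℝ) (r : ℝ), 0 < r → LaplaceType.PiecewiseContinuous f →
      LaplaceType.ExpOrder f r →
        ∀ s : ℝ, 2 * r < s → MemLp f 2 (LaplaceType.weight s)) ∧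
    -- `rt` inverts `gt`
    (∀ (s : ℝ) (hs : 0 < s) (f : ℝ → ℝ) (hf : MemLp f 2 (LaplaceType.weight s)),
      (∀ n : ℕ, LaplaceType.GtConverges f n s) ∧
      LaplaceType.gt f ∈ LaplaceType.Sc s ∧
      HasSum (LaplaceType.rtTerm hs (LaplaceType.gt f)) (hf.toLp f) ∧
      LaplaceType.rt hs (LaplaceType.gt f) = hf.toLp f) ∧
    -- `gt` inverts `rt`
    (∀ (s : ℝ) (hs : 0 < s) (φ : ℕ → ℝ → ℝ), φ ∈ LaplaceType.Sc s →
      HasSum (LaplaceType.rtTerm hs φ) (LaplaceType.rt hs φ) ∧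
      ∀ f : ℝ → ℝ, f =ᵐ[LaplaceType.weight s] LaplaceType.rt hs φ →
        ∀ n : ℕ, LaplaceType.GtConverges f n s ∧ LaplaceType.gt f n s = φ n s) := by
  exact ⟨fun f r _ hf hr s hs => LaplaceType.memLp_of_expOrder hf hr hs,
    fun s hs f hf => ⟨LaplaceType.gtConverges_of_memLp hs hf, LaplaceType.gt_mem_Sc hs hf,
      LaplaceType.hasSum_rtTerm_gt hs hf, (LaplaceType.hasSum_rtTerm_gt hs hf).tsum_eq⟩,
    fun s hs φ hφ => ⟨LaplaceType.hasSum_rtTerm hs hφ,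
      fun f hf n => LaplaceType.gt_rt hs hφ hf n⟩⟩
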